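/- **Theorem 1.** For a nonzero integer $q$, a $D(q)$-pair is a set $\{a,b\}$ of two distinct positive integers such that $ab+q$ is a perfect square; let $D_{2,q}(N)$ denote the number of $D(q)$-pairs contained in $\{1,2,\dots,N\}$. Let $\chi_{8,5}$ and $\chi_{8,3}$ be the Dirichlet characters modulo $8$ whose values at $1,3,5,7$ are $1,-1,-1,1$ and $1,1,-1,-1$ respectively, and let $L(s,\chi)$ denote the Dirichlet $L$-function of $\chi$ and $\zeta$ the Riemann zeta function. Then, as $N\to\infty$, $$D_{2,2}(N)\sim \frac{L(1,\chi_{8,5})}{\zeta(2)}\cdot N,\qquad D_{2,-2}(N)\sim \frac{L(1,\chi_{8,3})}{\zeta(2)}\cdot N,$$ where $$\frac{L(1,\chi_{8,5})}{\zeta(2)}\approx 0.37888,\qquad \frac{L(1,\chi_{8,3})}{\zeta(2)}\approx 0.67524,$$ both numerical values being correct to within $5\cdot 10^{-6}$. -/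

import Mathlib

open Filter Asymptotics

/-- A finite set `S` of natural numbers is a `D(q)`-`m`-tuple if it consists of `m` positive
integers such that `a * b + q` is a perfect square for all distinct `a, b ∈ S`. -/
def IsDTuple (m : ℕ) (q : ℤ) (S : Finset ℕ) : Prop :=
  S.card = m ∧ (∀ a ∈ S, 0 < a) ∧
    ∀ a ∈ S, ∀ b ∈ S, a ≠ b → IsSquare ((a : ℤ) * (b : ℤ) + q)

instance instDecidablePredIsDTuple (m : ℕ) (q : ℤ) : DecidablePred (IsDTuple m q) := fun S => by
  unfold IsDTuple
  infer_instance

/-- `D_{m,q}(N)`: the number of `D(q)`-`m`-tuples contained in `{1, 2, …, N}`. -/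
def dTupleCount (m : ℕ) (q : ℤ) (N : ℕ) : ℕ :=
  ((Finset.Icc 1 N).powerset.filter (IsDTuple m q)).card

/-- The Dirichlet character `χ_{8,5}` modulo `8`, with values `1, -1, -1, 1` at `1, 3, 5, 7`. -/
noncomputable def chiEightFive : DirichletCharacter ℂ 8 :=
  ZMod.χ₈.ringHomComp (Int.castRingHom ℂ)

/-- The Dirichlet character `χ_{8,3}` modulo `8`, with values `1, 1, -1, -1` at `1, 3, 5, 7`. -/
noncomputable def chiEightThree : DirichletCharacter ℂ 8 :=
  ZMod.χ₈'.ringHomComp (Int.castRingHom ℂ)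

/-! For `b ≥ 3` and `q = ±2`, the solutions `0 < a < b` of `a * b + q = r ^ 2` correspond to the
square roots `r` of `q` modulo `b` (`card_filter_isSquare_eq_sqrtCount`). Up to a constant, the pair
count is thus the summatory function of `sqrtCount q`.

On prime powers this multiplicative function agrees with `μ² * χ`, where `χ` is the quadratic
character of `q` (`sqrtCount_eq`). Its sum up to `N` is therefore `∑ χ(e) Q(N / e)`, with `Q`
counting squarefree integers. Since `Q(n) / n → 6 / π² = 1 / ζ(2)` and the partial sums of `χ` are
bounded, Abel's inequality makes the large `e` negligible, and the mean value is `L(1, χ) / ζ(2)`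
(`tendsto_sum_mul_div_of_density`).

Summing `χ(n) / n` in blocks of 8 gives absolute convergence. This identifies the sum with the
continued `L`-function at 1 (`hasSum_blockTerm_one`), and telescoping bounds on the tail give the
decimals. -/

/-! ### Square roots modulo `n` and the quadratic character -/

/-- The number of square roots of `q` modulo `n`, as an arithmetic function. -/
noncomputable def sqrtCount (q : ℤ) : ArithmeticFunction ℤ :=
  ⟨fun n => if n = 0 then 0 else ({x : ZMod n | x ^ 2 = q}.ncard : ℤ), by simp⟩

theorem sqrtCount_apply (q : ℤ) {n : ℕ} (hn : n ≠ 0) :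
    sqrtCount q n = {x : ZMod n | x ^ 2 = q}.ncard := by
  simp [sqrtCount, hn]

theorem isMultiplicative_sqrtCount (q : ℤ) : (sqrtCount q).IsMultiplicative := by
  rw [ArithmeticFunction.IsMultiplicative.iff_ne_zero]
  constructor
  · rw [sqrtCount_apply q one_ne_zero]
    have : {x : ZMod 1 | x ^ 2 = q} = {0} := by
      ext x
      simp [Subsingleton.elim x 0, eq_iff_true_of_subsingleton]
    rw [this]; simp
  · intro m n hm hn h
    rw [sqrtCount_apply q hm, sqrtCount_apply q hn, sqrtCount_apply q (mul_ne_zero hm hn)]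
    have e : {x : ZMod (m * n) | x ^ 2 = q} = (ZMod.chineseRemainder h) ⁻¹'
        ({x : ZMod m | x ^ 2 = q} ×ˢ {x : ZMod n | x ^ 2 = q}) := by
      ext x
      simp only [Set.mem_ofPred_eq, Set.mem_preimage, Set.mem_prod]
      rw [← (ZMod.chineseRemainder h).injective.eq_iff, map_pow, map_intCast, Prod.ext_iff]
      simp
    rw [e, Set.ncard_preimage_of_injective_subset_range (ZMod.chineseRemainder h).injective
      (by simp [(ZMod.chineseRemainder h).surjective.range_eq]), Set.ncard_prod]
    push_cast; rfl

/-- Hensel lifting of a square root modulo an odd prime. -/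
theorem exists_sq_sub_dvd_prime_pow {p : ℕ} (hp : p.Prime) (hp2 : p ≠ 2) {q : ℤ}
    (hq : ¬ (p : ℤ) ∣ q) (h : ∃ r : ℤ, (p : ℤ) ∣ r ^ 2 - q) (k : ℕ) :
    ∃ r : ℤ, (p : ℤ) ^ (k + 1) ∣ r ^ 2 - q := by
  induction k with
  | zero => simpa using h
  | succ k ih =>
    obtain ⟨r, c, hc⟩ := ih
    have hpZ : Prime (p : ℤ) := Nat.prime_iff_prime_int.mp hp
    have h2r : IsCoprime (p : ℤ) (2 * r) := by
      rw [Prime.coprime_iff_not_dvd hpZ]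
      intro hd
      rcases hpZ.dvd_or_dvd hd with h2 | hr
      · have : p ∣ 2 := by exact_mod_cast h2
        exact hp2 ((Nat.prime_dvd_prime_iff_eq hp Nat.prime_two).mp this)
      · apply hq
        have h1 : (p : ℤ) ∣ r ^ 2 - q := hc ▸ (dvd_pow_self _ (by simp)).mul_right c
        have := dvd_sub (hr.mul_left r) h1
        rwa [← pow_two, sub_sub_cancel] at this
    obtain ⟨u, v, huv⟩ := h2r
    -- Newton's step for `r ^ 2 - q`, with `v` the inverse of the derivative `2 * r` modulo `p`.
    refine ⟨r - v * c * p ^ (k + 1), c * u + v ^ 2 * c ^ 2 * p ^ k, ?_⟩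
    linear_combination hc - (p : ℤ) ^ (k + 1) * c * huv

/-- If `r` is a root, any root `x` makes `p ^ (k + 1)` divide `(r - x) * (-r - x)`. Since `p ∤ 2 *
r`, only one factor can absorb `p`, so `x = ± r`, and these two are distinct. -/
theorem ncard_sqrt_prime_pow {p : ℕ} (hp : p.Prime) (hp2 : p ≠ 2) {q : ℤ}
    (hq : ¬ (p : ℤ) ∣ q) (k : ℕ) :
    ((IsSquare (q : ZMod p)) → {x : ZMod (p ^ (k + 1)) | x ^ 2 = q}.ncard = 2) ∧
    ((¬ IsSquare (q : ZMod p)) → {x : ZMod (p ^ (k + 1)) | x ^ 2 = q}.ncard = 0) := by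
  have hpZ : Prime (p : ℤ) := Nat.prime_iff_prime_int.mp hp
  constructor
  · rintro ⟨y, hy⟩
    obtain ⟨r, hr⟩ := exists_sq_sub_dvd_prime_pow hp hp2 hq (by
      obtain ⟨y, rfl⟩ := ZMod.intCast_surjective y
      refine ⟨y, ?_⟩
      rw [← ZMod.intCast_zmod_eq_zero_iff_dvd]
      · push_cast; rw [hy]; ring) k
    have key : ¬ (p : ℤ) ∣ 2 * r := by
      intro hd
      rcases hpZ.dvd_or_dvd hd with h2 | h1
      · have : p ∣ 2 := by exact_mod_cast h2
        exact hp2 ((Nat.prime_dvd_prime_iff_eq hp Nat.prime_two).mp this)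
      · apply hq
        have h1' : (p : ℤ) ∣ r ^ 2 - q := (dvd_pow_self _ (by simp)).trans hr
        have := dvd_sub (h1.mul_left r) h1'
        rwa [← pow_two, sub_sub_cancel] at this
    have e : {x : ZMod (p ^ (k + 1)) | x ^ 2 = q} =
        {(r : ZMod (p ^ (k + 1))), ((-r : ℤ) : ZMod (p ^ (k + 1)))} := by
      have hrq : (r : ZMod (p ^ (k + 1))) ^ 2 = q := by
        rw [← Int.cast_pow, ZMod.intCast_eq_intCast_iff_dvd_sub, dvd_sub_comm]
        exact_mod_cast hr
      ext x
      simp only [Set.mem_ofPred_eq, Set.mem_insert_iff, Set.mem_singleton_iff]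
      constructor
      · intro hx
        obtain ⟨x, rfl⟩ := ZMod.intCast_surjective x
        rw [← hrq, ← Int.cast_pow, ← Int.cast_pow,
          ZMod.intCast_eq_intCast_iff_dvd_sub] at hx
        rw [ZMod.intCast_eq_intCast_iff_dvd_sub, ZMod.intCast_eq_intCast_iff_dvd_sub]
        push_cast at hx ⊢
        have hx' : (p : ℤ) ^ (k + 1) ∣ (r - x) * (-r - x) := by
          have := dvd_neg.mpr hx
          rwa [show -((r : ℤ) ^ 2 - x ^ 2) = (r - x) * (-r - x) by ring] at this
        by_cases h1 : (p : ℤ) ∣ r - x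
        · left
          have h2 : ¬ (p : ℤ) ∣ -r - x := fun h2 => key (by
            have := dvd_sub h1 h2
            rwa [show r - x - (-r - x) = 2 * r by ring] at this)
          exact (((Prime.coprime_iff_not_dvd hpZ).mpr h2).pow_left).dvd_of_dvd_mul_right hx'
        · right
          exact (((Prime.coprime_iff_not_dvd hpZ).mpr h1).pow_left).dvd_of_dvd_mul_left hx'
      · rintro (rfl | rfl)
        · exact hrq
        · rw [← hrq]; push_cast; ring
    rw [e]
    apply Set.ncard_pair
    rw [Ne, ZMod.intCast_eq_intCast_iff_dvd_sub]
    intro hd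
    apply key
    push_cast at hd
    have : (p : ℤ) ∣ -r - r := (dvd_pow_self _ (by simp)).trans hd
    rwa [← dvd_neg, show -(2 * r) = -r - r by ring]
  · intro h
    have e : {x : ZMod (p ^ (k + 1)) | x ^ 2 = q} = ∅ := by
      ext x
      simp only [Set.mem_ofPred_eq, Set.mem_empty_iff_false, iff_false]
      intro hx
      apply h
      refine ⟨ZMod.castHom (dvd_pow_self p (Nat.succ_ne_zero k)) (ZMod p) x, ?_⟩
      rw [← pow_two, ← map_pow, hx, map_intCast]
    rw [e, Set.ncard_empty]

/-- Such a `q` is not a square modulo 4, so only the modulus 2 admits a root. -/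
theorem sqrtCount_two_pow {q : ℤ} (hq : q % 4 = 2) (k : ℕ) :
    sqrtCount q (2 ^ (k + 1)) = if k = 0 then 1 else 0 := by
  rw [sqrtCount_apply q (by positivity)]
  split_ifs with hk
  · subst hk
    have e : {x : ZMod (2 ^ (0 + 1)) | x ^ 2 = q} = {0} := by
      have h0 : (q : ZMod (2 ^ (0 + 1))) = 0 := by
        rw [ZMod.intCast_zmod_eq_zero_iff_dvd]; push_cast; omega
      ext x
      simp [h0]
    rw [e]; simp
  · have e : {x : ZMod (2 ^ (k + 1)) | x ^ 2 = q} = ∅ := by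
      ext x
      simp only [Set.mem_ofPred_eq, Set.mem_empty_iff_false, iff_false]
      intro hx
      have hd : 4 ∣ 2 ^ (k + 1) := by
        obtain ⟨j, rfl⟩ := Nat.exists_eq_succ_of_ne_zero hk
        exact ⟨2 ^ j, by rw [pow_succ, pow_succ]; ring⟩
      have h4 := congrArg (ZMod.castHom hd (ZMod 4)) hx
      rw [map_pow, map_intCast, show (q : ZMod 4) = 2 from by
        rw [← Int.cast_ofNat, ZMod.intCast_eq_intCast_iff_dvd_sub]; push_cast; omega] at h4
      generalize (ZMod.castHom hd (ZMod 4)) x = y at h4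
      revert y
      decide
    rw [e]; simp

open ArithmeticFunction in
-- Among the powers of `p`, `μ²` is supported on `1` and `p`.
theorem pmul_moebius_mul_prime_pow (f : ArithmeticFunction ℤ) {p : ℕ} (hp : p.Prime) (k : ℕ) :
    (pmul moebius moebius * f) (p ^ (k + 1)) = f (p ^ (k + 1)) + f (p ^ k) := by
  rw [mul_apply, Nat.sum_divisorsAntidiagonal (fun a b => (pmul moebius moebius) a * f b),
    Nat.sum_divisors_prime_pow hp, Finset.sum_range_succ', Finset.sum_range_succ']
  rw [Finset.sum_eq_zero]
  · have : p ^ (k + 1) / p = p ^ k := by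
      rw [pow_succ, Nat.mul_div_cancel _ hp.pos]
    simp [moebius_apply_prime hp, this, add_comm]
  · intro i _
    simp [moebius_apply_prime_pow hp]

open ArithmeticFunction LSeries in
/-- `n ↦ #{x mod n | x² = q}` is the convolution of `μ²` with the quadratic character of `q`. -/
theorem sqrtCount_eq {q : ℤ} (hq : q % 4 = 2) {χ : DirichletCharacter ℤ 8}
    (hodd : ∀ p : ℕ, p.Prime → p ≠ 2 → ¬ (p : ℤ) ∣ q ∧
      ((IsSquare (q : ZMod p) ∧ χ p = 1) ∨ (¬ IsSquare (q : ZMod p) ∧ χ p = -1))) :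
    sqrtCount q = pmul moebius moebius * toArithmeticFunction (χ ·) := by
  rw [IsMultiplicative.eq_iff_eq_on_prime_powers _ (isMultiplicative_sqrtCount q) _
    ((isMultiplicative_moebius.pmul isMultiplicative_moebius).mul
      (DirichletCharacter.isMultiplicative_toArithmeticFunction χ))]
  intro p k hp
  cases k with
  | zero =>
    rw [pow_zero, (isMultiplicative_sqrtCount q).map_one,
      ((isMultiplicative_moebius.pmul isMultiplicative_moebius).mul
      (DirichletCharacter.isMultiplicative_toArithmeticFunction χ)).map_one]
  | succ k =>
    rw [pmul_moebius_mul_prime_pow _ hp,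
      ← DirichletCharacter.apply_eq_toArithmeticFunction_apply χ (pow_ne_zero _ hp.ne_zero),
      ← DirichletCharacter.apply_eq_toArithmeticFunction_apply χ (pow_ne_zero _ hp.ne_zero)]
    rw [Nat.cast_pow, Nat.cast_pow, map_pow χ, map_pow χ]
    -- At 2, `χ` vanishes and the right side is `0 ^ k`. At odd `p`, `χ(p) ^ (k + 1) + χ(p) ^ k` is
    -- 2 or 0 according as `χ(p)` is 1 or -1.
    by_cases hp2 : p = 2
    · subst hp2
      have h2 : χ ((2 : ℕ) : ZMod 8) = 0 := MulChar.map_nonunit χ (by decide)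
      rw [sqrtCount_two_pow hq, h2]
      rcases eq_or_ne k 0 with rfl | hk <;> simp [*]
    · obtain ⟨hd, h⟩ := hodd p hp hp2
      obtain ⟨h1, h2⟩ := ncard_sqrt_prime_pow hp hp2 hd k
      rw [sqrtCount_apply q (pow_ne_zero _ hp.ne_zero)]
      rcases h with ⟨hs, hc⟩ | ⟨hs, hc⟩
      · rw [h1 hs, hc]; simp
      · rw [h2 hs, hc, pow_succ]; simp

theorem odd_prime_not_dvd_two {p : ℕ} (hp : p.Prime) (hp2 : p ≠ 2) : ¬ (p : ℤ) ∣ 2 := by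
  intro h
  have : p ∣ 2 := by exact_mod_cast h
  exact hp2 ((Nat.prime_dvd_prime_iff_eq hp Nat.prime_two).mp this)

open ArithmeticFunction LSeries in
theorem sqrtCount_two :
    sqrtCount 2 = pmul moebius moebius * toArithmeticFunction (ZMod.χ₈ ·) := by
  refine sqrtCount_eq (by norm_num) fun p hp hp2 => ⟨odd_prime_not_dvd_two hp hp2, ?_⟩
  have := Fact.mk hp
  have h2 := hp.eq_two_or_odd.resolve_left hp2
  rw [Int.cast_ofNat, ZMod.exists_sq_eq_two_iff hp2, ZMod.χ₈_nat_eq_if_mod_eight]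
  split_ifs <;> simp_all

open ArithmeticFunction LSeries in
theorem sqrtCount_neg_two :
    sqrtCount (-2) = pmul moebius moebius * toArithmeticFunction (ZMod.χ₈' ·) := by
  refine sqrtCount_eq (by norm_num) fun p hp hp2 =>
    ⟨by rw [dvd_neg]; exact odd_prime_not_dvd_two hp hp2, ?_⟩
  have := Fact.mk hp
  have h2 := hp.eq_two_or_odd.resolve_left hp2
  rw [Int.cast_neg, Int.cast_ofNat, ZMod.exists_sq_eq_neg_two_iff hp2, ZMod.χ₈'_nat_eq_if_mod_eight]
  split_ifs <;> simp_all

/-! ### Abel summation and mean values of hyperbolic sums -/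

theorem tendsto_natCast_div_div (e : ℕ) :
    Tendsto (fun N : ℕ => ((N / e : ℕ) : ℝ) / N) atTop (nhds (1 / e)) := by
  have := (tendsto_nat_floor_mul_div_atTop (R := ℝ) (a := 1 / e) (by positivity)).comp
    tendsto_natCast_atTop_atTop
  refine this.congr fun N => ?_
  simp only [Function.comp]
  rw [one_div_mul_eq_div, Nat.floor_div_eq_div]

theorem natCast_div_div_le (N e : ℕ) : ((N / e : ℕ) : ℝ) / N ≤ 1 / e := by
  rcases Nat.eq_zero_or_pos N with rfl | hN
  · simp
  rw [div_le_iff₀ (by exact_mod_cast hN), one_div_mul_eq_div]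
  exact Nat.cast_div_le

/-- Summation by parts: once the boundary term is removed, each step adds a partial sum times `g n -
g (n + 1)`, and these bounds telescope. -/
theorem sum_mul_sub_partial_sum_mul_le {c g : ℕ → ℝ} {B : ℝ} (hg : Antitone g)
    (hc : ∀ n, |∑ i ∈ Finset.range n, c i| ≤ B) (n : ℕ) :
    |∑ i ∈ Finset.range n, c i * g i - (∑ i ∈ Finset.range n, c i) * g n| ≤ B * (g 0 - g n) := by
  induction n with
  | zero => simp
  | succ n ih =>
    have h1 : ∑ i ∈ Finset.range (n + 1), c i * g i - (∑ i ∈ Finset.range (n + 1), c i) * g (n + 1)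
        = (∑ i ∈ Finset.range n, c i * g i - (∑ i ∈ Finset.range n, c i) * g n) +
          (∑ i ∈ Finset.range (n + 1), c i) * (g n - g (n + 1)) := by
      rw [Finset.sum_range_succ, Finset.sum_range_succ]; ring
    rw [h1]
    have h2 : 0 ≤ g n - g (n + 1) := sub_nonneg.mpr (hg (Nat.le_succ n))
    calc _ ≤ _ := abs_add_le _ _
      _ ≤ B * (g 0 - g n) + B * (g n - g (n + 1)) := by
        rw [abs_mul, abs_of_nonneg h2]
        gcongr
        exact hc _
      _ = _ := by ring

/-- **Abel's inequality**. -/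
theorem abs_sum_mul_le_of_antitone {c g : ℕ → ℝ} {B : ℝ} (hg : Antitone g) (hg0 : ∀ n, 0 ≤ g n)
    (hc : ∀ n, |∑ i ∈ Finset.range n, c i| ≤ B) (n : ℕ) :
    |∑ i ∈ Finset.range n, c i * g i| ≤ B * g 0 := by
  have h1 := sum_mul_sub_partial_sum_mul_le hg hc n
  have h2 : |(∑ i ∈ Finset.range n, c i) * g n| ≤ B * g n := by
    rw [abs_mul, abs_of_nonneg (hg0 n)]
    exact mul_le_mul_of_nonneg_right (hc n) (hg0 n)
  have h3 := abs_add_le (∑ i ∈ Finset.range n, c i * g i - (∑ i ∈ Finset.range n, c i) * g n)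
    ((∑ i ∈ Finset.range n, c i) * g n)
  rw [sub_add_cancel] at h3
  linarith

/-- If `Q` is a counting function of density `c`, and `χ` is an oscillating sequence, then the
hyperbolic sum of `χ` against `Q` has mean value `c * ∑ χ(e) / e`. -/
theorem tendsto_sum_mul_div_of_density {χ Q : ℕ → ℝ} {B c L : ℝ} {k : ℕ} (hk : 0 < k)
    (hχ : ∀ M n, |∑ i ∈ Finset.range n, χ (k * M + i)| ≤ B)
    (hχ0 : χ 0 = 0)
    (hL : Tendsto (fun M : ℕ => ∑ e ∈ Finset.range (k * M), χ e / e) atTop (nhds L))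
    (hQm : Monotone Q) (hQ0 : ∀ n, 0 ≤ Q n) (hQle : ∀ n, Q n ≤ n)
    (hQ : Tendsto (fun n : ℕ => Q n / n) atTop (nhds c)) :
    Tendsto (fun N : ℕ => (∑ e ∈ Finset.Ioc 0 N, χ e * Q (N / e)) / N) atTop (nhds (c * L)) := by
  have hterm (e : ℕ) : Tendsto (fun N : ℕ => χ e * Q (N / e) / N) atTop (nhds (c * (χ e / e))) := by
    rcases Nat.eq_zero_or_pos e with rfl | he
    · simp [hχ0]
    have h1 := (hQ.comp (Nat.tendsto_div_const_atTop he.ne')).mul (tendsto_natCast_div_div e)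
    have h2 := h1.const_mul (χ e)
    rw [show c * (χ e / e) = χ e * (c * (1 / e)) by ring]
    refine h2.congr fun N => ?_
    simp only [Function.comp]
    rcases Nat.eq_zero_or_pos (N / e) with h | h
    · have : Q 0 = 0 := le_antisymm (by simpa using hQle 0) (hQ0 0)
      simp [h, this]
    · have : ((N / e : ℕ) : ℝ) ≠ 0 := by exact_mod_cast h.ne'
      field_simp
  have hB : 0 ≤ B := (abs_nonneg _).trans (hχ 0 0)
  -- Abel's inequality bounds the terms with `e ≥ k * M` by `B * Q (N / (k * M))`, which is at most
  -- `B * N / M`.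
  have htail (M : ℕ) (hM : 0 < M) (N : ℕ) (hN : k * M ≤ N) :
      |(∑ e ∈ Finset.Ioc 0 N, χ e * Q (N / e)) / N -
        ∑ e ∈ Finset.range (k * M), χ e * Q (N / e) / N| ≤ B / M := by
    have hN0 : (0 : ℝ) < N := by exact_mod_cast (Nat.mul_pos hk hM).trans_le hN
    have h1 : ∑ e ∈ Finset.Ioc 0 N, χ e * Q (N / e) =
        ∑ e ∈ Finset.range (k * M), χ e * Q (N / e) +
        ∑ i ∈ Finset.range (N + 1 - k * M), χ (k * M + i) * Q (N / (k * M + i)) := by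
      rw [← Finset.sum_range_add (fun e => χ e * Q (N / e)),
        Nat.add_sub_cancel' (hN.trans N.le_succ), Finset.sum_range_succ', hχ0, zero_mul, add_zero,
        Finset.range_eq_Ico, Finset.sum_Ico_add' (fun e => χ e * Q (N / e)) 0 N 1]
      rfl
    rw [h1, ← Finset.sum_div, add_div, add_sub_cancel_left, abs_div, abs_of_pos hN0,
      div_le_iff₀ hN0]
    have h2 := abs_sum_mul_le_of_antitone (c := fun i => χ (k * M + i))
      (g := fun i => Q (N / (k * M + i))) (B := B) (fun i j hij => hQm (Nat.div_le_div_left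
        (by omega) (by positivity))) (fun n => hQ0 _) (hχ M) (N + 1 - k * M)
    refine h2.trans ?_
    rw [div_mul_eq_mul_div, mul_div_assoc]
    refine mul_le_mul_of_nonneg_left ?_ hB
    refine (hQle _).trans (Nat.cast_div_le.trans ?_)
    have : (M : ℝ) ≤ ((k * M + 0 : ℕ) : ℝ) := by
      exact_mod_cast Nat.le_mul_of_pos_left M hk
    have hM' : (0 : ℝ) < M := by exact_mod_cast hM
    gcongr
  rw [Metric.tendsto_atTop]
  intro ε hε
  have hBM : Tendsto (fun M : ℕ => B / (M : ℝ)) atTop (nhds 0) :=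
    tendsto_const_div_atTop_nhds_zero_nat B
  -- `M` is fixed first, making both the tail and the truncation of `L` small; only then does `N`
  -- grow.
  obtain ⟨M, hM1, hM2, hM0⟩ := ((hBM.eventually_lt_const (u := ε / 3) (by positivity)).and
    (((Metric.tendsto_nhds.mp (hL.const_mul c)) (ε / 3) (by positivity)).and
      (eventually_gt_atTop 0))).exists
  have hA : Tendsto (fun N : ℕ => ∑ e ∈ Finset.range (k * M), χ e * Q (N / e) / N) atTop
      (nhds (c * ∑ e ∈ Finset.range (k * M), χ e / e)) := by
    rw [Finset.mul_sum]
    exact tendsto_finsetSum _ fun e _ => hterm e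
  obtain ⟨N₀, hN₀⟩ := Metric.tendsto_atTop.mp hA (ε / 3) (by positivity)
  refine ⟨max N₀ (k * M), fun N hN => ?_⟩
  have a1 := htail M hM0 N ((le_max_right _ _).trans hN)
  have a2 := hN₀ N ((le_max_left _ _).trans hN)
  rw [Real.dist_eq] at a2 hM2 ⊢
  rw [abs_lt] at a2 hM2 ⊢
  rw [abs_le] at a1
  constructor <;> linarith [a1.1, a1.2, a2.1, a2.2, hM2.1, hM2.2]

/-! ### Density of the squarefree integers -/

/-- After division by `gcd k a`, the square of the cofactor of `k` is coprime to that of `a`, hence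
divides `b` and is 1. -/
theorem dvd_of_sq_dvd_sq_mul_squarefree {k a b : ℕ} (ha : a ≠ 0) (hb : Squarefree b)
    (h : k ^ 2 ∣ a ^ 2 * b) : k ∣ a := by
  obtain ⟨k', a', hco, hk, ha'⟩ := Nat.exists_coprime k a
  have hg : 0 < Nat.gcd k a := Nat.gcd_pos_of_pos_right _ (Nat.pos_of_ne_zero ha)
  have h : (k' * k.gcd a) ^ 2 ∣ (a' * k.gcd a) ^ 2 * b := by rwa [← hk, ← ha']
  rw [mul_pow, mul_pow, mul_right_comm] at h
  have h1 := (Nat.mul_dvd_mul_iff_right (pow_pos hg 2)).mp h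
  have h2 : k' ^ 2 ∣ b := (hco.pow 2 2).dvd_of_dvd_mul_left h1
  have h3 : k' = 1 := Nat.isUnit_iff.mp (hb k' (by rwa [← pow_two]))
  rw [hk, h3, one_mul]
  exact Nat.gcd_dvd_right _ _

open ArithmeticFunction in
-- With `n = a ^ 2 * b` and `b` squarefree, `k ^ 2 ∣ n` means `k ∣ a`, and `∑ μ(k)` over `k ∣ a`
-- detects `a = 1`. The common range up to `N` allows the sums over `n` and `k` to be exchanged.
theorem moebius_sq_eq_sum {n N : ℕ} (hn : n ≠ 0) (hN : n ≤ N) :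
    moebius n * moebius n = ∑ k ∈ Finset.Ioc 0 N with k ^ 2 ∣ n, moebius k := by
  obtain ⟨b, a, hab, hb⟩ := Nat.sq_mul_squarefree n
  have hab0 : a ≠ 0 := by rintro rfl; simp at hab; omega
  have e : {k ∈ Finset.Ioc 0 N | k ^ 2 ∣ n} = a.divisors := by
    ext k
    simp only [Finset.mem_filter, Finset.mem_Ioc, Nat.mem_divisors]
    constructor
    · rintro ⟨_, h⟩
      exact ⟨dvd_of_sq_dvd_sq_mul_squarefree hab0 hb (hab.symm ▸ h), hab0⟩
    · rintro ⟨h, _⟩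
      have h2 : k ^ 2 ∣ n := hab ▸ (pow_dvd_pow_of_dvd h 2).mul_right b
      have h3 : k ∣ n := (dvd_pow_self k two_ne_zero).trans h2
      exact ⟨⟨Nat.pos_of_dvd_of_pos h3 (Nat.pos_of_ne_zero hn),
        (Nat.le_of_dvd (Nat.pos_of_ne_zero hn) h3).trans hN⟩, h2⟩
  rw [e, ← coe_mul_zeta_apply, moebius_mul_coe_zeta, ← pow_two, moebius_sq, one_apply]
  congr 1
  rw [eq_iff_iff]
  constructor
  · intro h
    have : a * a ∣ n := by rw [← pow_two, ← hab]; exact dvd_mul_right _ _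
    exact Nat.isUnit_iff.mp (h a this)
  · rintro rfl
    simpa [← hab] using hb

/-- The number of squarefree integers up to `n`. -/
def squarefreeCount (n : ℕ) : ℤ :=
  ∑ d ∈ Finset.Ioc 0 n, ArithmeticFunction.pmul ArithmeticFunction.moebius ArithmeticFunction.moebius d

open ArithmeticFunction in
theorem squarefreeCount_eq (N : ℕ) :
    squarefreeCount N = ∑ k ∈ Finset.Ioc 0 N, moebius k * ((N / k ^ 2 : ℕ) : ℤ) := by
  have : squarefreeCount N = ∑ d ∈ Finset.Ioc 0 N, ∑ k ∈ Finset.Ioc 0 N,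
      if k ^ 2 ∣ d then moebius k else 0 := by
    refine Finset.sum_congr rfl fun d hd => ?_
    rw [Finset.mem_Ioc] at hd
    rw [pmul_apply, moebius_sq_eq_sum hd.1.ne' hd.2, Finset.sum_filter]
  rw [this, Finset.sum_comm]
  refine Finset.sum_congr rfl fun k _ => ?_
  rw [← Finset.sum_filter, Finset.sum_const, Nat.Ioc_filter_dvd_card_eq_div, nsmul_eq_mul, mul_comm]

open ArithmeticFunction in
theorem hasSum_moebius_div_sq :
    HasSum (fun k : ℕ => (moebius k : ℝ) * (1 / ((k ^ 2 : ℕ) : ℝ))) (6 / Real.pi ^ 2) := by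
  rw [← Complex.hasSum_ofReal]
  have h1 := (LSeriesSummable_moebius_iff (s := 2)).mpr (by norm_num)
  have h2 := h1.LSeriesHasSum
  have h3 : LSeries (fun n => ((moebius n : ℤ) : ℂ)) 2 = ((6 / Real.pi ^ 2 : ℝ) : ℂ) := by
    have := LSeries_zeta_mul_Lseries_moebius (s := 2) (by norm_num)
    rw [LSeries_zeta_eq_riemannZeta (by norm_num), riemannZeta_two] at this
    have hpi : (Real.pi : ℂ) ≠ 0 := by exact_mod_cast Real.pi_ne_zero
    push_cast
    field_simp at this ⊢
    linear_combination this
  rw [← h3]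
  refine h2.congr_fun fun k => ?_
  rcases eq_or_ne k 0 with rfl | hk
  · simp
  · rw [LSeries.term_of_ne_zero hk]
    push_cast
    rw [← Complex.cpow_natCast (k : ℂ) 2]
    push_cast
    ring

/-- Dominated convergence: each `⌊n / k²⌋ / n` tends to `1 / k²` and is bounded by it. -/
theorem tendsto_squarefreeCount_div :
    Tendsto (fun n : ℕ => (squarefreeCount n : ℝ) / n) atTop (nhds (6 / Real.pi ^ 2)) := by
  rw [← hasSum_moebius_div_sq.tsum_eq]
  have e (n : ℕ) : (squarefreeCount n : ℝ) / n =
      ∑' k : ℕ, (ArithmeticFunction.moebius k : ℝ) * (((n / k ^ 2 : ℕ) : ℝ) / n) := by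
    rw [squarefreeCount_eq, tsum_eq_sum (s := Finset.Ioc 0 n)]
    · push_cast
      rw [Finset.sum_div]
      exact Finset.sum_congr rfl fun k _ => mul_div_assoc _ _ _
    · intro k hk
      rw [Finset.mem_Ioc, not_and_or, not_lt, not_le, Nat.le_zero] at hk
      rcases hk with rfl | hk
      · simp
      · rw [Nat.div_eq_of_lt (hk.trans_le (Nat.le_self_pow two_ne_zero k))]
        simp
  simp_rw [e]
  refine tendsto_tsum_of_dominated_convergence (bound := fun k : ℕ => 1 / (k : ℝ) ^ 2)
    (Real.summable_one_div_nat_pow.mpr one_lt_two)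
    (fun k => (tendsto_natCast_div_div (k ^ 2)).const_mul _) (Eventually.of_forall fun n k => ?_)
  rw [norm_mul, Real.norm_eq_abs, Real.norm_eq_abs, abs_of_nonneg (by positivity :
    (0 : ℝ) ≤ ((n / k ^ 2 : ℕ) : ℝ) / n)]
  have h1 : |(ArithmeticFunction.moebius k : ℝ)| ≤ 1 := by
    exact_mod_cast ArithmeticFunction.abs_moebius_le_one (n := k)
  have h2 := natCast_div_div_le n (k ^ 2)
  push_cast at h2
  calc _ ≤ 1 * (1 / (k : ℝ) ^ 2) := by gcongr
    _ = _ := one_mul _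

open ArithmeticFunction in
theorem pmul_moebius_self_eq_zero_or_one (d : ℕ) :
    pmul moebius moebius d = 0 ∨ pmul moebius moebius d = (1 : ℤ) := by
  rw [pmul_apply, ← pow_two, moebius_sq]
  split_ifs <;> simp

theorem squarefreeCount_mono : Monotone squarefreeCount := by
  intro m n h
  refine Finset.sum_le_sum_of_subset_of_nonneg (Finset.Ioc_subset_Ioc_right h) fun d _ _ => ?_
  rcases pmul_moebius_self_eq_zero_or_one d with h | h <;> simp [h]

theorem squarefreeCount_nonneg (n : ℕ) : 0 ≤ squarefreeCount n :=
  Finset.sum_nonneg fun d _ => by rcases pmul_moebius_self_eq_zero_or_one d with h | h <;> simp [h]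

theorem squarefreeCount_le (n : ℕ) : squarefreeCount n ≤ n := by
  calc squarefreeCount n ≤ ∑ d ∈ Finset.Ioc 0 n, (1 : ℤ) :=
        Finset.sum_le_sum fun d _ => by rcases pmul_moebius_self_eq_zero_or_one d with h | h <;> simp [h]
    _ = n := by simp

/-! ### The value `L(1, χ)` as a sum over blocks of length 8 -/

/-- Full periods cancel, leaving fewer than 8 terms. -/
theorem abs_periodic_sum_le {c : ℕ → ℤ} (hc : ∀ n, |c n| ≤ 1) (hp : ∀ n, c (n + 8) = c n)
    (hs : ∀ a, ∑ i ∈ Finset.range 8, c (a + i) = 0) (a n : ℕ) :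
    |∑ i ∈ Finset.range n, c (a + i)| ≤ 8 := by
  induction n using Nat.strong_induction_on with
  | _ n ih =>
    rcases lt_or_ge n 8 with h | h
    · calc _ ≤ ∑ i ∈ Finset.range n, |c (a + i)| := Finset.abs_sum_le_sum_abs _ _
        _ ≤ ∑ i ∈ Finset.range n, 1 := Finset.sum_le_sum fun i _ => hc _
        _ ≤ 8 := by simp; omega
    · obtain ⟨m, rfl⟩ := Nat.exists_eq_add_of_le' h
      rw [add_comm m 8, Finset.sum_range_add, hs, zero_add]
      simp_rw [show ∀ i, c (a + (8 + i)) = c (a + i) from fun i => by rw [← hp (a + i)]; congr 1; omega]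
      exact ih m (by omega)

/-- Factor out `x ^ (-s) ≤ 1 / x`; what remains is at most `1 - (x / y) ^ 2 ≤ 2 * (y - x) / y ≤ 14 /
x`. The bound is uniform in `s`, as dominated convergence at `s = 1` requires. -/
theorem abs_rpow_neg_sub_rpow_neg_le {x y s : ℝ} (hx : 1 ≤ x) (hxy : x ≤ y) (hyx : y ≤ x + 7)
    (hs1 : 1 ≤ s) (hs2 : s ≤ 2) : |y ^ (-s) - x ^ (-s)| ≤ 14 / x ^ 2 := by
  have hx0 : 0 < x := by linarith
  have hy0 : 0 < y := by linarith
  have h1 : y ^ (-s) ≤ x ^ (-s) := Real.rpow_le_rpow_of_nonpos hx0 hxy (by linarith)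
  rw [abs_sub_comm, abs_of_nonneg (sub_nonneg.mpr h1)]
  have h2 : x ^ (-s) - y ^ (-s) = x ^ (-s) * (1 - (x / y) ^ s) := by
    rw [Real.div_rpow hx0.le hy0.le, Real.rpow_neg hx0.le, Real.rpow_neg hy0.le]
    have := (Real.rpow_pos_of_pos hx0 s).ne'
    field_simp
  have h3 : x ^ (-s) ≤ x⁻¹ := by
    rw [← Real.rpow_neg_one]
    exact Real.rpow_le_rpow_of_exponent_le hx (by linarith)
  have h4 : (x / y) ^ 2 ≤ (x / y) ^ s := by
    rw [← Real.rpow_two]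
    exact Real.rpow_le_rpow_of_exponent_ge (by positivity) ((div_le_one hy0).mpr hxy) hs2
  have h5 : 1 - (x / y) ^ s ≤ 14 / x := by
    have : 1 - (x / y) ^ 2 ≤ 14 / x := by
      rw [div_pow, one_sub_div (by positivity), div_le_div_iff₀ (by positivity) hx0]
      nlinarith [mul_nonneg (sub_nonneg.mpr hxy) hy0.le, mul_nonneg (sub_nonneg.mpr hyx) hy0.le,
        mul_nonneg (mul_nonneg (sub_nonneg.mpr hxy) hy0.le) hx0.le,
        mul_nonneg (mul_nonneg (sub_nonneg.mpr hyx) hy0.le) hx0.le]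
    linarith
  have h6 : 0 ≤ 1 - (x / y) ^ s :=
    sub_nonneg.mpr (Real.rpow_le_one (by positivity) ((div_le_one hy0).mpr hxy) (by linarith))
  rw [h2]
  calc _ ≤ x⁻¹ * (14 / x) := mul_le_mul h3 h5 h6 (by positivity)
    _ = 14 / x ^ 2 := by field_simp

/-- The sum of the terms of the Dirichlet series of `χ` at `s` over the `m`-th block of length
`8`. -/
noncomputable def blockTerm (χ : DirichletCharacter ℤ 8) (s : ℝ) (m : ℕ) : ℝ :=
  ∑ j ∈ Finset.range 8, (χ (j : ZMod 8) : ℝ) * (8 * m + j : ℝ) ^ (-s)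

theorem abs_char_le_one (χ : DirichletCharacter ℤ 8) (a : ZMod 8) : |χ a| ≤ 1 := by
  by_cases ha : IsUnit a
  · obtain ⟨u, rfl⟩ := ha
    have h1 : χ (u : ZMod 8) ^ 2 = 1 := by
      rw [← map_pow, show (u : ZMod 8) ^ 2 = 1 by revert u; decide, map_one]
    exact (sq_le_one_iff_abs_le_one _).mp h1.le
  · simp [MulChar.map_nonunit χ ha]

/-- Because `χ` sums to zero over a period, `(8 * m + 1) ^ (-s)` may be subtracted from every power.
Seven differences of size at most `14 / (m + 1) ^ 2` remain, whence 98. -/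
theorem abs_blockTerm_le {χ : DirichletCharacter ℤ 8}
    (hsum : ∑ i ∈ Finset.range 8, χ (i : ZMod 8) = 0) {s : ℝ} (hs1 : 1 ≤ s) (hs2 : s ≤ 2) (m : ℕ) :
    |blockTerm χ s m| ≤ 98 / (m + 1 : ℝ) ^ 2 := by
  have h0 : χ ((0 : ℕ) : ZMod 8) = 0 := MulChar.map_nonunit χ (by decide)
  have hsum' : ∑ i ∈ Finset.range 7, (χ ((i + 1 : ℕ) : ZMod 8) : ℝ) = 0 := by
    rw [Finset.sum_range_succ', h0, add_zero] at hsum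
    exact_mod_cast hsum
  have e : blockTerm χ s m = ∑ i ∈ Finset.range 7, (χ ((i + 1 : ℕ) : ZMod 8) : ℝ) *
      ((8 * m + 1 + i : ℝ) ^ (-s) - (8 * m + 1 : ℝ) ^ (-s)) := by
    simp_rw [mul_sub]
    rw [Finset.sum_sub_distrib, ← Finset.sum_mul, hsum', zero_mul, sub_zero, blockTerm,
      Finset.sum_range_succ', h0, Int.cast_zero, zero_mul, add_zero]
    refine Finset.sum_congr rfl fun i _ => ?_
    push_cast
    ring_nf
  rw [e]
  calc _ ≤ ∑ i ∈ Finset.range 7, |(χ ((i + 1 : ℕ) : ZMod 8) : ℝ) *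
      ((8 * m + 1 + i : ℝ) ^ (-s) - (8 * m + 1 : ℝ) ^ (-s))| := Finset.abs_sum_le_sum_abs _ _
    _ ≤ ∑ i ∈ Finset.range 7, 14 / (m + 1 : ℝ) ^ 2 := by
      refine Finset.sum_le_sum fun i hi => ?_
      have hi7 : (i : ℝ) ≤ 7 := by
        exact_mod_cast (Finset.mem_range.mp hi).le
      have hm : (0 : ℝ) ≤ m := m.cast_nonneg
      have hi0 : (0 : ℝ) ≤ i := i.cast_nonneg
      have h1 := abs_rpow_neg_sub_rpow_neg_le (x := 8 * m + 1) (y := 8 * m + 1 + i)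
        (by linarith) (by linarith) (by linarith) hs1 hs2
      rw [abs_mul]
      have h2 : |(χ ((i + 1 : ℕ) : ZMod 8) : ℝ)| ≤ 1 := by exact_mod_cast abs_char_le_one χ _
      calc _ ≤ 1 * (14 / (8 * m + 1 : ℝ) ^ 2) := by gcongr
        _ ≤ 14 / (m + 1 : ℝ) ^ 2 := by
          rw [one_mul]
          gcongr
          linarith
    _ = _ := by rw [Finset.sum_const, Finset.card_range, nsmul_eq_mul]; push_cast; ring

theorem summable_block_bound : Summable fun m : ℕ => 98 / (m + 1 : ℝ) ^ 2 := by
  have := (summable_nat_add_iff 1).mpr (Real.summable_one_div_nat_pow.mpr one_lt_two)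
  refine (this.mul_left 98).congr fun m => ?_
  push_cast
  ring

theorem hasSum_blockTerm {χ : DirichletCharacter ℤ 8} {s : ℝ} (hs : 1 < s) :
    HasSum (fun m => (blockTerm χ s m : ℂ))
      (DirichletCharacter.LFunction (χ.ringHomComp (Int.castRingHom ℂ)) s) := by
  have hs' : 1 < (s : ℂ).re := by simpa using hs
  have h1 := (DirichletCharacter.LSeriesSummable_of_one_lt_re
    (χ.ringHomComp (Int.castRingHom ℂ)) hs').LSeriesHasSum
  rw [DirichletCharacter.LFunction_eq_LSeries _ hs']
  have h2 := ((Nat.divModEquiv 8).symm.hasSum_iff.mpr h1).prod_fiberwise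
    (fun m => hasSum_fintype _)
  refine h2.congr_fun fun m => ?_
  rw [blockTerm, Finset.sum_range]
  push_cast
  refine Finset.sum_congr rfl fun j _ => ?_
  simp only [Function.comp, Nat.divModEquiv_symm_apply]
  have h8 : (8 : ZMod 8) = 0 := rfl
  have hn : ((m * 8 + (j : ℕ) : ℕ) : ZMod 8) = ((j : ℕ) : ZMod 8) := by
    push_cast; rw [h8]; ring
  rw [LSeries.term_def]
  split_ifs with h
  · have hj : (j : ℕ) = 0 := by omega
    rw [hj, MulChar.map_nonunit χ (by decide)]
    simp
  · rw [hn, MulChar.ringHomComp_apply, div_eq_mul_inv, ← Complex.cpow_neg,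
      Complex.ofReal_cpow (by positivity)]
    push_cast
    rw [mul_comm (8 : ℂ)]
    rfl

/-- At 1 the `L`-function is defined by continuation, so the two sides are compared as `s → 1⁺`: the
left is continuous since `χ` is nontrivial, the right by dominated convergence. -/
theorem hasSum_blockTerm_one {χ : DirichletCharacter ℤ 8}
    (hsum : ∑ i ∈ Finset.range 8, χ (i : ZMod 8) = 0) :
    ∃ L : ℝ, DirichletCharacter.LFunction (χ.ringHomComp (Int.castRingHom ℂ)) 1 = L ∧
      HasSum (blockTerm χ 1) L := by
  have hS : Summable (blockTerm χ 1) :=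
    Summable.of_norm_bounded summable_block_bound fun m => abs_blockTerm_le hsum le_rfl one_le_two m
  refine ⟨∑' m, blockTerm χ 1 m, ?_, hS.hasSum⟩
  have hne : (χ.ringHomComp (Int.castRingHom ℂ)) ≠ 1 := by
    intro h
    have h1 (a : ZMod 8) (ha : IsUnit a) : χ a = 1 := by
      have := congrArg (fun f => f a) h
      simp only [MulChar.ringHomComp_apply, MulChar.one_apply ha, eq_intCast] at this
      exact_mod_cast this
    have h0 (a : ZMod 8) (ha : ¬ IsUnit a) : χ a = 0 := MulChar.map_nonunit χ ha
    simp only [Finset.sum_range_succ, Finset.sum_range_zero] at hsum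
    rw [h0 _ (by decide), h1 _ (by decide), h0 _ (by decide), h1 _ (by decide), h0 _ (by decide),
      h1 _ (by decide), h0 _ (by decide), h1 _ (by decide)] at hsum
    norm_num at hsum
  have hc : Tendsto (fun s : ℝ => DirichletCharacter.LFunction
      (χ.ringHomComp (Int.castRingHom ℂ)) s) (nhdsWithin 1 (Set.Ioi 1))
      (nhds (DirichletCharacter.LFunction (χ.ringHomComp (Int.castRingHom ℂ)) ((1 : ℝ) : ℂ))) :=
    (((DirichletCharacter.differentiable_LFunction hne).continuous.comp
      Complex.continuous_ofReal).tendsto 1).mono_left nhdsWithin_le_nhds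
  rw [Complex.ofReal_one] at hc
  have ht : Tendsto (fun s : ℝ => ∑' m, blockTerm χ s m) (nhdsWithin 1 (Set.Ioi 1))
      (nhds (∑' m, blockTerm χ 1 m)) := by
    refine tendsto_tsum_of_dominated_convergence summable_block_bound (fun m => ?_) ?_
    · refine Tendsto.mono_left ?_ nhdsWithin_le_nhds
      refine tendsto_finsetSum _ fun j _ => ?_
      rcases Nat.eq_zero_or_pos j with rfl | hj
      · rw [MulChar.map_nonunit χ (by decide)]
        simp
      · have hpos : (8 * m + j : ℝ) ≠ 0 := by positivity
        exact ((Real.continuous_const_rpow hpos).comp continuous_neg).tendsto 1 |>.const_mul _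
    · have : Set.Ioc (1 : ℝ) 2 ∈ nhdsWithin 1 (Set.Ioi 1) := Ioc_mem_nhdsGT one_lt_two
      filter_upwards [this] with s hs m
      exact abs_blockTerm_le hsum hs.1.le hs.2 m
  refine tendsto_nhds_unique hc ?_
  refine ((Complex.continuous_ofReal.tendsto _).comp ht).congr' ?_
  filter_upwards [self_mem_nhdsWithin] with s hs
  rw [Function.comp, Complex.ofReal_tsum]
  exact (hasSum_blockTerm hs).tsum_eq

theorem tendsto_sum_char_div {χ : DirichletCharacter ℤ 8} {L : ℝ} (h : HasSum (blockTerm χ 1) L) :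
    Tendsto (fun M : ℕ => ∑ e ∈ Finset.range (8 * M), (χ (e : ZMod 8) : ℝ) / e) atTop (nhds L) := by
  refine h.tendsto_sum_nat.congr fun M => ?_
  induction M with
  | zero => simp
  | succ M ih =>
    rw [Finset.sum_range_succ, ih, mul_add_one, Finset.sum_range_add, blockTerm]
    congr 1
    refine Finset.sum_congr rfl fun j _ => ?_
    have h8 : (8 : ZMod 8) = 0 := rfl
    push_cast
    rw [h8, zero_mul, zero_add, Real.rpow_neg_one, div_eq_mul_inv]

/-! ### Mean value of `sqrtCount` -/

open ArithmeticFunction LSeries in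
theorem tendsto_sum_sqrtCount_div {q : ℤ} {χ : DirichletCharacter ℤ 8} {L : ℝ}
    (hq : sqrtCount q = pmul moebius moebius * toArithmeticFunction (χ ·))
    (hsum : ∀ a : ℕ, ∑ i ∈ Finset.range 8, χ ((a + i : ℕ) : ZMod 8) = 0)
    (hL : HasSum (blockTerm χ 1) L) :
    Tendsto (fun N : ℕ => ((∑ n ∈ Finset.Ioc 0 N, sqrtCount q n : ℤ) : ℝ) / N) atTop
      (nhds (6 / Real.pi ^ 2 * L)) := by
  have h0 : χ ((0 : ℕ) : ZMod 8) = 0 := MulChar.map_nonunit χ (by decide)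
  have h8 : (8 : ZMod 8) = 0 := rfl
  refine (tendsto_sum_mul_div_of_density (χ := fun n => (χ (n : ZMod 8) : ℝ))
    (Q := fun n => (squarefreeCount n : ℝ)) (B := 8) (k := 8) (by norm_num) (fun M n => ?_)
    (by exact_mod_cast h0) (tendsto_sum_char_div hL)
    (fun m n h => Int.cast_mono (squarefreeCount_mono h))
    (fun n => by exact_mod_cast squarefreeCount_nonneg n)
    (fun n => by exact_mod_cast squarefreeCount_le n) tendsto_squarefreeCount_div).congr fun N => ?_
  · exact_mod_cast abs_periodic_sum_le (c := fun n => χ (n : ZMod 8))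
      (fun n => abs_char_le_one χ _) (fun n => by push_cast; rw [h8, add_zero])
      hsum (8 * M) n
  · rw [hq, mul_comm (pmul moebius moebius), sum_Ioc_mul_eq_sum_sum]
    push_cast
    congr 1
    refine Finset.sum_congr rfl fun n hn => ?_
    rw [← DirichletCharacter.apply_eq_toArithmeticFunction_apply χ
      (Finset.mem_Ioc.mp hn).1.ne', squarefreeCount]
    push_cast
    rfl

/-! ### Numerical bounds for `L(1, χ)` -/

/-- From `M` on, partial sum plus `T` is nondecreasing, and it tends to `L`. -/
theorem le_of_hasSum_of_telescoping {b T : ℕ → ℝ} {L : ℝ} (hb : HasSum b L)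
    (hT : Tendsto T atTop (nhds 0)) (M : ℕ) (h : ∀ m ≥ M, T m - T (m + 1) ≤ b m) :
    ∑ m ∈ Finset.range M, b m + T M ≤ L := by
  have h1 : ∀ n ≥ M, ∑ m ∈ Finset.range M, b m + T M ≤ ∑ m ∈ Finset.range n, b m + T n := by
    intro n hn
    induction n, hn using Nat.le_induction with
    | base => exact le_rfl
    | succ n hn ih =>
      rw [Finset.sum_range_succ]
      linarith [h n hn]
  have h2 := hb.tendsto_sum_nat.add hT
  rw [add_zero] at h2
  exact ge_of_tendsto h2 (eventually_atTop.mpr ⟨M, h1⟩)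

theorem hasSum_le_of_telescoping {b T : ℕ → ℝ} {L : ℝ} (hb : HasSum b L)
    (hT : Tendsto T atTop (nhds 0)) (M : ℕ) (h : ∀ m ≥ M, b m ≤ T m - T (m + 1)) :
    L ≤ ∑ m ∈ Finset.range M, b m + T M := by
  have := le_of_hasSum_of_telescoping hb.neg (T := fun m => -T m) (by simpa using hT.neg) M
    (fun m hm => by linarith [h m hm])
  rw [Finset.sum_neg_distrib] at this
  linarith

theorem blockTerm_chi_eight (m : ℕ) : blockTerm ZMod.χ₈ 1 m =
    1 / (8 * m + 1 : ℝ) - 1 / (8 * m + 3) - 1 / (8 * m + 5) + 1 / (8 * m + 7) := by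
  simp [blockTerm, Finset.sum_range_succ, Real.rpow_neg_one]
  ring

theorem blockTerm_chi_eight' (m : ℕ) : blockTerm ZMod.χ₈' 1 m =
    1 / (8 * m + 1 : ℝ) + 1 / (8 * m + 3) - 1 / (8 * m + 5) - 1 / (8 * m + 7) := by
  simp [blockTerm, Finset.sum_range_succ, Real.rpow_neg_one]
  ring

/-- With `x = 8 * m`, the tail is close to `1 / x ^ 2`, and `c` tunes the sign of the error. The
leading coefficient vanishes at `c = 11`, leaving a positive remainder; at `c = 10.9` the numerator
is negative for `m ≥ 8`. -/
theorem even_block_sub_telescope {x c : ℝ} (hx : 0 ≤ x) (hc : 0 < c) :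
    1 / (x + 1) - 1 / (x + 3) - 1 / (x + 5) + 1 / (x + 7) -
      (1 / (x ^ 2 + c) - 1 / ((x + 8) ^ 2 + c)) =
    16 * (x + 4) * ((2 * c - 22) * (x + 4) ^ 2 + (247 + 32 * c + c ^ 2)) /
      ((x + 1) * (x + 3) * (x + 5) * (x + 7) * (x ^ 2 + c) * ((x + 8) ^ 2 + c)) := by
  have : x ^ 2 + c ≠ 0 := by positivity
  have : (x + 8) ^ 2 + c ≠ 0 := by positivity
  field_simp
  ring

/-- Here the tail is close to `1 / x`. The critical value is `c = 3`, which gives the lower bound;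
`c = 2.95` gives the upper one. -/
theorem odd_block_sub_telescope {x c : ℝ} (hx : 0 ≤ x) (hc : 0 < c) :
    1 / (x + 1) + 1 / (x + 3) - 1 / (x + 5) - 1 / (x + 7) -
      (x / (x ^ 2 + c) - (x + 8) / ((x + 8) ^ 2 + c)) =
    8 * ((3 * c - 9) * (x + 4) ^ 4 +
      ((16 + c) ^ 2 - 3 * (2 * c - 32) - (9 + 10 * (16 + c))) * (x + 4) ^ 2
      + (9 * (16 + c) - 3 * (16 + c) ^ 2)) /
      ((x + 1) * (x + 3) * (x + 5) * (x + 7) * (x ^ 2 + c) * ((x + 8) ^ 2 + c)) := by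
  have : x ^ 2 + c ≠ 0 := by positivity
  have : (x + 8) ^ 2 + c ≠ 0 := by positivity
  field_simp
  ring

theorem tendsto_eight_mul : Tendsto (fun m : ℕ => 8 * (m : ℝ)) atTop atTop :=
  tendsto_natCast_atTop_atTop.const_mul_atTop (by norm_num)

theorem tendsto_one_div_sq_add (c : ℝ) :
    Tendsto (fun m : ℕ => 1 / ((8 * m : ℝ) ^ 2 + c)) atTop (nhds 0) := by
  simp_rw [one_div]
  exact tendsto_inv_atTop_zero.comp
    (tendsto_atTop_add_const_right _ c ((tendsto_pow_atTop two_ne_zero).comp tendsto_eight_mul))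

theorem tendsto_div_sq_add {c : ℝ} (hc : 0 < c) :
    Tendsto (fun m : ℕ => (8 * m : ℝ) / ((8 * m : ℝ) ^ 2 + c)) atTop (nhds 0) := by
  refine squeeze_zero' (Eventually.of_forall fun m => by positivity) ?_
    (tendsto_inv_atTop_zero.comp tendsto_eight_mul)
  filter_upwards [eventually_gt_atTop 0] with m hm
  have : (0 : ℝ) < m := by exact_mod_cast hm
  rw [Function.comp, div_le_iff₀ (by positivity), inv_mul_eq_div, le_div_iff₀ (by positivity)]
  nlinarith

theorem LSeries_chi_eight_bounds {L : ℝ} (h : HasSum (blockTerm ZMod.χ₈ 1) L) :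
    0.6232252 ≤ L ∧ L ≤ 0.6232253 := by
  constructor
  · refine le_trans ?_ (le_of_hasSum_of_telescoping h (tendsto_one_div_sq_add 11) 8 fun m _ => ?_)
    · simp only [blockTerm_chi_eight, Finset.sum_range_succ, Finset.sum_range_zero]
      norm_num
    · have h1 := even_block_sub_telescope (x := 8 * m) (c := 11) (by positivity) (by norm_num)
      rw [blockTerm_chi_eight, ← sub_nonneg]
      push_cast
      rw [mul_add, mul_one, h1]
      norm_num
      positivity
  · refine le_trans (hasSum_le_of_telescoping h (tendsto_one_div_sq_add 10.9) 8 fun m hm => ?_) ?_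
    · have h1 := even_block_sub_telescope (x := 8 * m) (c := 10.9) (by positivity) (by norm_num)
      rw [blockTerm_chi_eight, ← sub_nonpos]
      push_cast
      rw [mul_add, mul_one, h1]
      have hm' : (8 : ℝ) ≤ m := by exact_mod_cast hm
      refine div_nonpos_of_nonpos_of_nonneg
        (mul_nonpos_of_nonneg_of_nonpos (by positivity) ?_) (by positivity)
      nlinarith
    · simp only [blockTerm_chi_eight, Finset.sum_range_succ, Finset.sum_range_zero]
      norm_num

theorem LSeries_chi_eight'_bounds {L : ℝ} (h : HasSum (blockTerm ZMod.χ₈' 1) L) :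
    1.11072 ≤ L ∧ L ≤ 1.110722 := by
  constructor
  · refine le_trans ?_ (le_of_hasSum_of_telescoping h (tendsto_div_sq_add (c := 3) (by norm_num)) 8
      fun m hm => ?_)
    · simp only [blockTerm_chi_eight', Finset.sum_range_succ, Finset.sum_range_zero]
      norm_num
    · have h1 := odd_block_sub_telescope (x := 8 * m) (c := 3) (by positivity) (by norm_num)
      rw [blockTerm_chi_eight', ← sub_nonneg]
      push_cast
      rw [mul_add, mul_one, h1]
      have hm' : (8 : ℝ) ≤ m := by exact_mod_cast hm
      refine div_nonneg (mul_nonneg (by norm_num) ?_) (by positivity)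
      nlinarith
  · refine le_trans (hasSum_le_of_telescoping h (tendsto_div_sq_add (c := 2.95) (by norm_num)) 8
      fun m hm => ?_) ?_
    · have h1 := odd_block_sub_telescope (x := 8 * m) (c := 2.95) (by positivity) (by norm_num)
      rw [blockTerm_chi_eight', ← sub_nonpos]
      push_cast
      rw [mul_add, mul_one, h1]
      have hm' : (8 : ℝ) ≤ m := by exact_mod_cast hm
      have hy : (68 : ℝ) ^ 2 ≤ (8 * m + 4 : ℝ) ^ 2 := by gcongr; linarith
      refine div_nonpos_of_nonpos_of_nonneg
        (mul_nonpos_of_nonneg_of_nonpos (by norm_num) ?_) (by positivity)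
      rw [show (8 * m + 4 : ℝ) ^ 4 = ((8 * m + 4 : ℝ) ^ 2) ^ 2 by ring]
      nlinarith
    · simp only [blockTerm_chi_eight', Finset.sum_range_succ, Finset.sum_range_zero]
      norm_num

/-! ### From pairs to square roots -/

/-- A root with representative `0 ≤ r < b` gives `a = (r ^ 2 - q) / b`. Here `a > 0` because neither
2 nor -2 is a square, and `a < b` because `(b - 1) ^ 2 + 2 < b ^ 2`. Conversely `r ^ 2 = a * b + q ≤
b ^ 2 - b + 2 < b ^ 2` forces `r < b`; this is where `b ≥ 3` enters. -/
theorem card_filter_isSquare_eq_sqrtCount {q : ℤ} (hq : q = 2 ∨ q = -2) {b : ℕ} (hb : 3 ≤ b) :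
    ((((Finset.Ioo 0 b).filter fun a : ℕ => IsSquare ((a : ℤ) * b + q)).card : ℕ) : ℤ) =
      sqrtCount q b := by
  have : NeZero b := ⟨by omega⟩
  have hbZ : (3 : ℤ) ≤ b := by exact_mod_cast hb
  have key (x : ZMod b) (hx : x ^ 2 = q) :
      ∃ a : ℤ, 0 < a ∧ a < b ∧ (x.val : ℤ) ^ 2 - q = b * a := by
    have hd : (b : ℤ) ∣ (x.val : ℤ) ^ 2 - q := by
      rw [← ZMod.intCast_zmod_eq_zero_iff_dvd]
      push_cast
      rw [ZMod.natCast_zmod_val, hx, sub_self]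
    obtain ⟨a, ha⟩ := hd
    have hv : (x.val : ℤ) + 1 ≤ b := by exact_mod_cast x.val_lt
    have hv0 : (0 : ℤ) ≤ x.val := by positivity
    refine ⟨a, ?_, ?_, ha⟩
    · rcases lt_trichotomy a 0 with h | h | h
      · exfalso
        have : (b : ℤ) * a ≤ -b := by nlinarith
        rcases hq with rfl | rfl <;> nlinarith
      · exfalso
        subst h
        rcases hq with rfl | rfl
        · have h2 : (x.val : ℤ) ^ 2 = 2 := by linarith
          have : (x.val : ℤ) < 2 := by nlinarith
          interval_cases h : (x.val : ℤ) <;> omega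
        · nlinarith
      · exact h
    · by_contra h
      push Not at h
      have h1 : (b : ℤ) * b ≤ b * a := by nlinarith
      have h2 : (x.val : ℤ) ^ 2 ≤ (b - 1) ^ 2 := by gcongr; linarith
      rcases hq with rfl | rfl <;> nlinarith
  rw [sqrtCount_apply q (by omega), ← Set.ncard_coe_finset]
  congr 1
  symm
  refine Set.ncard_congr (fun x _ => (((x.val : ℤ) ^ 2 - q) / b).toNat) ?_ ?_ ?_
  · intro x hx
    obtain ⟨a, ha0, hab, ha⟩ := key x hx
    rw [ha, Int.mul_ediv_cancel_left _ (by omega)]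
    lift a to ℕ using ha0.le
    simp only [Int.toNat_natCast, Finset.coe_filter, Finset.mem_Ioo, Set.mem_ofPred_eq]
    refine ⟨⟨by exact_mod_cast ha0, by exact_mod_cast hab⟩, x.val, ?_⟩
    linarith
  · intro x y hx hy hxy
    obtain ⟨a, ha0, hab, ha⟩ := key x hx
    obtain ⟨a', ha0', hab', ha'⟩ := key y hy
    rw [ha, ha', Int.mul_ediv_cancel_left _ (by omega), Int.mul_ediv_cancel_left _ (by omega)]
      at hxy
    have haa : a = a' := by omega
    subst haa
    have h2 : (x.val : ℤ) ^ 2 = (y.val : ℤ) ^ 2 := by linarith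
    have h3 : x.val = y.val := by
      have : x.val ^ 2 = y.val ^ 2 := by exact_mod_cast h2
      exact Nat.pow_left_injective two_ne_zero this
    exact ZMod.val_injective b h3
  · intro a ha
    simp only [Finset.coe_filter, Finset.mem_Ioo, Set.mem_ofPred_eq] at ha
    obtain ⟨⟨ha0, hab⟩, r, hr⟩ := ha
    rw [← Int.natAbs_mul_self] at hr
    generalize r.natAbs = r at hr
    push_cast at hr
    have habZ : (a : ℤ) + 1 ≤ b := by exact_mod_cast hab
    have hrb : r < b := by
      by_contra h
      push Not at h
      have : (b : ℤ) ≤ r := by exact_mod_cast h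
      rcases hq with rfl | rfl <;> nlinarith
    refine ⟨(r : ZMod b), ?_, ?_⟩
    · have := congrArg (fun z : ℤ => (z : ZMod b)) hr
      push_cast at this
      rw [ZMod.natCast_self, mul_zero, zero_add] at this
      rw [Set.mem_ofPred_eq, pow_two, this]
    · simp only [ZMod.val_cast_of_lt hrb]
      rw [pow_two, ← hr, add_sub_cancel_right, Int.mul_ediv_cancel _ (by omega), Int.toNat_natCast]

/-- Each pair is indexed by its larger element `b`. -/
theorem dTupleCount_two_eq (q : ℤ) (N : ℕ) : dTupleCount 2 q N = ∑ b ∈ Finset.Ioc 0 N,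
    ((Finset.Ioo 0 b).filter fun a : ℕ => IsSquare ((a : ℤ) * b + q)).card := by
  rw [← Finset.card_sigma, dTupleCount]
  symm
  refine Finset.card_bij (fun p _ => {p.2, p.1}) ?_ ?_ ?_
  · rintro ⟨b, a⟩ h
    simp only [Finset.mem_sigma, Finset.mem_Ioc, Finset.mem_filter, Finset.mem_Ioo] at h
    obtain ⟨⟨hb0, hbN⟩, ⟨ha0, hab⟩, hs⟩ := h
    simp only [Finset.mem_filter, Finset.mem_powerset, Finset.insert_subset_iff,
      Finset.singleton_subset_iff, Finset.mem_Icc, IsDTuple, Finset.mem_insert,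
      Finset.mem_singleton]
    refine ⟨⟨⟨ha0, by omega⟩, hb0, hbN⟩, Finset.card_pair hab.ne, ?_, ?_⟩
    · rintro x (rfl | rfl) <;> assumption
    · rintro x (rfl | rfl) y (rfl | rfl) hxy
      · exact absurd rfl hxy
      · exact hs
      · rwa [mul_comm]
      · exact absurd rfl hxy
  · rintro ⟨b, a⟩ h ⟨b', a'⟩ h' e
    simp only [Finset.mem_sigma, Finset.mem_Ioc, Finset.mem_filter, Finset.mem_Ioo] at h h'
    have e1 : a ∈ ({a', b'} : Finset ℕ) := by rw [← e]; simp
    have e2 : b ∈ ({a', b'} : Finset ℕ) := by rw [← e]; simp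
    simp only [Finset.mem_insert, Finset.mem_singleton] at e1 e2
    obtain rfl : a = a' := by omega
    obtain rfl : b = b' := by omega
    rfl
  · intro S hS
    simp only [Finset.mem_filter, Finset.mem_powerset, IsDTuple] at hS
    obtain ⟨hSN, hc, _, hs⟩ := hS
    obtain ⟨x, y, hxy, rfl⟩ := Finset.card_eq_two.mp hc
    simp only [Finset.insert_subset_iff, Finset.singleton_subset_iff, Finset.mem_Icc] at hSN
    obtain ⟨⟨hx0, hxN⟩, hy0, hyN⟩ := hSN
    rcases lt_or_gt_of_ne hxy with h | h
    · refine ⟨⟨y, x⟩, ?_, rfl⟩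
      simp only [Finset.mem_sigma, Finset.mem_Ioc, Finset.mem_filter, Finset.mem_Ioo]
      exact ⟨⟨hy0, hyN⟩, ⟨hx0, h⟩, hs x (by simp) y (by simp) hxy⟩
    · refine ⟨⟨x, y⟩, ?_, Finset.pair_comm _ _⟩
      simp only [Finset.mem_sigma, Finset.mem_Ioc, Finset.mem_filter, Finset.mem_Ioo]
      exact ⟨⟨hx0, hxN⟩, ⟨hy0, h⟩, hs y (by simp) x (by simp) hxy.symm⟩

/-- The constant absorbs `b = 1, 2`, where the correspondence with roots is not available. -/
theorem exists_dTupleCount_two_eq {q : ℤ} (hq : q = 2 ∨ q = -2) :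
    ∃ C : ℤ, ∀ N ≥ 2, (dTupleCount 2 q N : ℤ) = ∑ n ∈ Finset.Ioc 0 N, sqrtCount q n + C := by
  refine ⟨dTupleCount 2 q 2 - ∑ n ∈ Finset.Ioc 0 2, sqrtCount q n, fun N hN => ?_⟩
  induction N, hN using Nat.le_induction with
  | base => ring
  | succ N hN ih =>
    rw [dTupleCount_two_eq] at ih ⊢
    rw [Finset.sum_Ioc_succ_top (Nat.zero_le N), Finset.sum_Ioc_succ_top (Nat.zero_le N),
      Nat.cast_add, ih, card_filter_isSquare_eq_sqrtCount hq (by omega)]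
    ring

/-! ### Asymptotic equivalence and conclusion -/

theorem isEquivalent_dTupleCount_two {q : ℤ} (hq : q = 2 ∨ q = -2) {K : ℝ} (hK : K ≠ 0)
    (h : Tendsto (fun N : ℕ => ((∑ n ∈ Finset.Ioc 0 N, sqrtCount q n : ℤ) : ℝ) / N) atTop
      (nhds K)) :
    (fun N : ℕ => (dTupleCount 2 q N : ℂ)) ~[atTop] fun N : ℕ => (K : ℂ) * (N : ℂ) := by
  obtain ⟨C, hC⟩ := exists_dTupleCount_two_eq hq
  have h1 := h.add (tendsto_const_div_atTop_nhds_zero_nat (C : ℝ))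
  have h2 := (Complex.continuous_ofReal.tendsto _).comp (h1.div_const K)
  rw [add_zero, div_self hK, Complex.ofReal_one] at h2
  rw [isEquivalent_iff_tendsto_one]
  · refine h2.congr' ?_
    filter_upwards [eventually_ge_atTop 2] with N hN
    have h3 : (dTupleCount 2 q N : ℂ) = ((∑ n ∈ Finset.Ioc 0 N, sqrtCount q n + C : ℤ) : ℂ) := by
      rw [← hC N hN]; simp
    simp only [Function.comp, Pi.div_apply]
    rw [h3]
    push_cast
    rw [← add_div, div_div, mul_comm (N : ℂ)]
  · filter_upwards [eventually_gt_atTop 0] with N hN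
    exact mul_ne_zero (by exact_mod_cast hK) (by exact_mod_cast hN.ne')

theorem isEquivalent_dTupleCount_two_and_norm_sub_le {q : ℤ} (hq : q = 2 ∨ q = -2) {ℓ w : ℂ} {L v : ℝ} (hℓ : ℓ = L) (hw : w = v)
    (hL : 0 < L)
    (h : Tendsto (fun N : ℕ => ((∑ n ∈ Finset.Ioc 0 N, sqrtCount q n : ℤ) : ℝ) / N) atTop
      (nhds (6 / Real.pi ^ 2 * L)))
    (h1 : (v - 5e-6) * Real.pi ^ 2 ≤ 6 * L) (h2 : 6 * L ≤ (v + 5e-6) * Real.pi ^ 2) :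
    ((fun N : ℕ => (dTupleCount 2 q N : ℂ)) ~[atTop] fun N : ℕ => ℓ / riemannZeta 2 * (N : ℂ)) ∧
      ‖ℓ / riemannZeta 2 - w‖ ≤ 5e-6 := by
  have hpi := Real.pi_pos
  have e : ℓ / riemannZeta 2 = ((6 / Real.pi ^ 2 * L : ℝ) : ℂ) := by
    have : (Real.pi : ℂ) ≠ 0 := by exact_mod_cast hpi.ne'
    rw [hℓ, riemannZeta_two]
    push_cast
    field_simp
  rw [e, hw]
  refine ⟨isEquivalent_dTupleCount_two hq (by positivity) h, ?_⟩
  rw [← Complex.ofReal_sub, Complex.norm_real, Real.norm_eq_abs, abs_le, neg_le_sub_iff_le_add,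
    div_mul_eq_mul_div, sub_le_iff_le_add, div_le_iff₀ (by positivity), ← sub_le_iff_le_add,
    le_div_iff₀ (by positivity)]
  exact ⟨h1, by linarith⟩

theorem pi_sq_bounds : 9.8696044 < Real.pi ^ 2 ∧ Real.pi ^ 2 < 9.8696045 := by
  constructor <;> nlinarith [Real.pi_gt_d20, Real.pi_lt_d20]

theorem theorem1 :
    (((fun N : ℕ => (dTupleCount 2 2 N : ℂ)) ~[atTop]
        fun N : ℕ => DirichletCharacter.LFunction chiEightFive 1 / riemannZeta 2 * (N : ℂ)) ∧
      ‖DirichletCharacter.LFunction chiEightFive 1 / riemannZeta 2 - 0.37888‖ ≤ 5e-6) ∧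
    (((fun N : ℕ => (dTupleCount 2 (-2) N : ℂ)) ~[atTop]
        fun N : ℕ => DirichletCharacter.LFunction chiEightThree 1 / riemannZeta 2 * (N : ℂ)) ∧
      ‖DirichletCharacter.LFunction chiEightThree 1 / riemannZeta 2 - 0.67524‖ ≤ 5e-6) := by
  obtain ⟨p1, p2⟩ := pi_sq_bounds
  have s1 (a : ℕ) : ∑ i ∈ Finset.range 8, ZMod.χ₈ ((a + i : ℕ) : ZMod 8) = 0 := by
    push_cast
    generalize (a : ZMod 8) = x
    revert x
    decide
  have s2 (a : ℕ) : ∑ i ∈ Finset.range 8, ZMod.χ₈' ((a + i : ℕ) : ZMod 8) = 0 := by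
    push_cast
    generalize (a : ZMod 8) = x
    revert x
    decide
  obtain ⟨L, hL, hLs⟩ := hasSum_blockTerm_one (χ := ZMod.χ₈) (by simpa using s1 0)
  obtain ⟨L', hL', hLs'⟩ := hasSum_blockTerm_one (χ := ZMod.χ₈') (by simpa using s2 0)
  obtain ⟨b1, b2⟩ := LSeries_chi_eight_bounds hLs
  obtain ⟨b1', b2'⟩ := LSeries_chi_eight'_bounds hLs'
  constructor
  · exact isEquivalent_dTupleCount_two_and_norm_sub_le (v := 0.37888) (Or.inl rfl) hL (by norm_num) (by linarith)
      (tendsto_sum_sqrtCount_div sqrtCount_two s1 hLs) (by norm_num; linarith) (by norm_num; linarith)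
  · exact isEquivalent_dTupleCount_two_and_norm_sub_le (v := 0.67524) (Or.inr rfl) hL' (by norm_num) (by linarith)
      (tendsto_sum_sqrtCount_div sqrtCount_neg_two s2 hLs') (by norm_num; linarith)
      (by norm_num; linarith)
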